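/- **Proposition (Fold map degenerates).** Let $\mathbb S^{M}$ be the unit sphere of $\mathbb R^{M+1}$ and $\overline{\mathbb B}^{N}$ the closed unit ball of $\mathbb R^{N}$, with $1\le N<M$. For $|x|<1$ and $|y|\le 1$ in $\mathbb R^{M+1}$ let $$T_x(y)=\frac{(1+2x\cdot y+|y|^2)\,x+(1-|x|^2)\,y}{1+2x\cdot y+|x|^2|y|^2}$$ be the Möbius transformation of the closed unit ball. For $p\in\mathbb S^M$ and $t\in[0,1)$ let $H_p=\{y\in\mathbb S^M: y\cdot p\le 0\}$, let $H_{p,t}=T_{tp}(H_p)$ be the corresponding closed spherical cap, let $R_p(y)=y-2(y\cdot p)p$, and let $R_{p,t}=T_{tp}\circ R_p\circ (T_{tp})^{-1}$ be the reflection of $\mathbb S^M$ across $\partial H_{p,t}$. The fold map $F_{p,t}:\mathbb S^M\to\mathbb S^M$ is defined by $F_{p,t}(y)=y$ if $y\in H_{p,t}$ and $F_{p,t}(y)=R_{p,t}(y)$ otherwise. Let $\gamma:\overline{\mathbb B}^{N}\to\mathbb S^{M}$ be a smooth embedding, that is, $\gamma$ is $C^\infty$ up to the boundary, injective, and has injective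 differential at every point of $\overline{\mathbb B}^{N}$. Then for every fixed $p\in\mathbb S^M$, $$\limsup_{t\to 1^-}\ \mathcal H_N\big(F_{p,t}\circ\gamma(\overline{\mathbb B}^{N})\big)\ \le\ \mathcal H_N(\mathbb S^{N})+\mathcal H_N\big(\gamma(\overline{\mathbb B}^{N})\big),$$ where $\mathcal H_N$ is the $N$-dimensional Hausdorff measure of Euclidean space, with the same normalization in all three terms (multiplying $\mathcal H_N$ by a positive constant does not affect the inequality), and $\mathbb S^N$ is the unit sphere of $\mathbb R^{N+1}$. -/

import Mathlib

open Set Filter Topology Metric MeasureTheory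
open scoped ContDiff

noncomputable section FoldMaps

variable {E : Type*} [NormedAddCommGroup E] [InnerProductSpace ℝ E]

/-- The Möbius transformation `T_x` of the closed unit ball, for a parameter `x` in the open unit
ball. It is only meant to be evaluated at `y` in the closed unit ball. -/
def mobius (x y : E) : E :=
  (1 + 2 * inner ℝ x y + ‖x‖ ^ 2 * ‖y‖ ^ 2)⁻¹ •
    ((1 + 2 * inner ℝ x y + ‖y‖ ^ 2) • x + (1 - ‖x‖ ^ 2) • y)

/-- The closed hemisphere `H_p` opposite to `p`. -/
def hemisphere (p : E) : Set E := {y ∈ sphere (0 : E) 1 | inner ℝ y p ≤ 0}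

/-- The closed spherical cap `H_{p,t} = T_{tp}(H_p)`. -/
def sphericalCap (p : E) (t : ℝ) : Set E := mobius (t • p) '' hemisphere p

/-- The linear reflection `R_b` in the hyperplane through the origin perpendicular to `b`. -/
def hyperplaneReflection (b y : E) : E := y - (2 * (inner ℝ y b / ‖b‖ ^ 2)) • b

/-- The reflection `R_{p,t} = T_{tp} ∘ R_p ∘ (T_{tp})⁻¹` of the unit sphere across the boundary of
`H_{p,t}`; the inverse of `T_{tp}` is `T_{-tp}`, see `mobius_neg_mobius`. -/
def capReflection (p : E) (t : ℝ) (y : E) : E :=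
  mobius (t • p) (hyperplaneReflection p (mobius (-(t • p)) y))

open Classical in
/-- The fold map `F_{p,t}` of the unit sphere: the identity on the cap `H_{p,t}`, the reflection
`R_{p,t}` off the cap. -/
def foldMap (p : E) (t : ℝ) (y : E) : E :=
  if y ∈ sphericalCap p t then y else capReflection p t y

/-- `γ` restricts to a smooth embedding of the closed unit ball of `ℝ^N` (a manifold with boundary)
into the unit sphere `S^M` of `ℝ^{M+1}`: it is `C^∞` up to the boundary, injective, and its
differential is injective at every point, boundary points included. The ball being compact, such a
map is a homeomorphism onto its image. Values of `γ` off the closed ball play no role. -/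
structure IsSmoothEmbeddedBall {N M : ℕ}
    (γ : EuclideanSpace ℝ (Fin N) → EuclideanSpace ℝ (Fin (M + 1))) : Prop where
  mapsTo : MapsTo γ (closedBall 0 1) (sphere 0 1)
  contDiffOn : ContDiffOn ℝ ∞ γ (closedBall 0 1)
  injOn : InjOn γ (closedBall 0 1)
  injective_fderivWithin : ∀ z ∈ closedBall (0 : EuclideanSpace ℝ (Fin N)) 1,
    Function.Injective (fderivWithin ℝ γ (closedBall 0 1) z)

/-- `T_x` maps the unit sphere to itself. -/
theorem norm_mobius {x y : E} (hx : ‖x‖ < 1) (hy : ‖y‖ = 1) : ‖mobius x y‖ = 1 := by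
  have hxy : |inner ℝ x y| ≤ ‖x‖ := by simpa [hy] using abs_real_inner_le_norm x y
  have hD : 0 < 1 + 2 * inner ℝ x y + ‖x‖ ^ 2 := by
    nlinarith [neg_abs_le (inner ℝ x y), norm_nonneg x]
  have h : ‖mobius x y‖ ^ 2 = 1 := by
    rw [← real_inner_self_eq_norm_sq]
    simp only [mobius, hy, inner_smul_left, inner_smul_right, inner_add_left, inner_add_right,
      real_inner_self_eq_norm_sq, real_inner_comm x y, RCLike.conj_to_real, one_pow, mul_one]
    field_simp
    ring
  nlinarith [norm_nonneg (mobius x y)]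

/-- `T_{-x}` inverts `T_x` on the unit sphere. -/
theorem mobius_neg_mobius {x y : E} (hx : ‖x‖ < 1) (hy : ‖y‖ = 1) :
    mobius (-x) (mobius x y) = y := by
  have hxy : |inner ℝ x y| ≤ ‖x‖ := by simpa [hy] using abs_real_inner_le_norm x y
  have hD : 0 < 1 + 2 * inner ℝ x y + ‖x‖ ^ 2 := by
    nlinarith [neg_abs_le (inner ℝ x y), norm_nonneg x]
  have hs : 0 < 1 - ‖x‖ ^ 2 := by nlinarith [norm_nonneg x]
  set a := inner ℝ x y with ha
  have hz : inner ℝ x (mobius x y) =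
      (2 * ‖x‖ ^ 2 + a + ‖x‖ ^ 2 * a) / (1 + 2 * a + ‖x‖ ^ 2) := by
    simp only [mobius, hy, inner_smul_right, inner_add_right, real_inner_self_eq_norm_sq, ← ha]
    field_simp
    ring
  have hn := norm_mobius hx hy
  have h1 : 1 + 2 * inner ℝ (-x) (mobius x y) + ‖-x‖ ^ 2 * ‖mobius x y‖ ^ 2 =
      (1 - ‖x‖ ^ 2) ^ 2 / (1 + 2 * a + ‖x‖ ^ 2) := by
    rw [inner_neg_left, norm_neg, hn, hz]
    field_simp
    ring
  have h2 : 1 + 2 * inner ℝ (-x) (mobius x y) + ‖mobius x y‖ ^ 2 =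
      2 * (1 - ‖x‖ ^ 2) * (1 + a) / (1 + 2 * a + ‖x‖ ^ 2) := by
    rw [inner_neg_left, hn, hz]
    field_simp
    ring
  rw [mobius, h1, h2, norm_neg, mobius, ← ha, hy]
  match_scalars <;> field_simp <;> ring

end FoldMaps

/-! ### Chordal distances under Möbius maps and cap reflections. -/

section FoldMapGeometry

variable {E : Type*} [NormedAddCommGroup E] [InnerProductSpace ℝ E]

/-! Off the cap, points lie within `√2 (1 - t)` of `p`, so by compactness only a small piece of `γ`
around a preimage of `p` is reflected, and none if `γ` misses `p`. The unmoved points contribute at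
most the measure of the image of `γ`.

For the reflected piece, `norm_capReflection_sub_sq` gives an exact chordal distance. As `t → 1` it
takes the form of the chordal distance of inverse stereographic projection after dilation by `2 / (1
- t) ^ 2`. Near `a` with `γ a = p`, `γ` is almost its differential, so the reflected piece is a
nearly 1-Lipschitz image of a subset of `S^N` (`norm_capReflection_sub_le`). The Lipschitz constant
is `(1 + η) / (1 - η) ^ 3` on a neighbourhood independent of `t`; finally `η → 0`. -/

theorem one_add_two_inner_add_norm_sq_pos {x y : E} (hx : ‖x‖ < 1) (hy : ‖y‖ = 1) :
    0 < 1 + 2 * inner ℝ x y + ‖x‖ ^ 2 := by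
  have hxy : |inner ℝ x y| ≤ ‖x‖ := by simpa [hy] using abs_real_inner_le_norm x y
  nlinarith [neg_abs_le (inner ℝ x y), norm_nonneg x]

/-- `T_x` is conformal on the sphere, and chords scale by the geometric mean of the conformal
factors at their two ends. -/
theorem norm_mobius_sub_mobius_sq {x y z : E} (hx : ‖x‖ < 1) (hy : ‖y‖ = 1) (hz : ‖z‖ = 1) :
    ‖mobius x y - mobius x z‖ ^ 2 = (1 - ‖x‖ ^ 2) ^ 2 * ‖y - z‖ ^ 2 /
      ((1 + 2 * inner ℝ x y + ‖x‖ ^ 2) * (1 + 2 * inner ℝ x z + ‖x‖ ^ 2)) := by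
  have hDy := one_add_two_inner_add_norm_sq_pos hx hy
  have hDz := one_add_two_inner_add_norm_sq_pos hx hz
  rw [norm_sub_sq_real, norm_sub_sq_real, norm_mobius hx hy, norm_mobius hx hz, hy, hz]
  simp only [mobius, hy, hz, inner_smul_left, inner_smul_right, inner_add_left, inner_add_right,
    real_inner_self_eq_norm_sq, real_inner_comm x y, RCLike.conj_to_real,
    one_pow, mul_one]
  field_simp
  ring

theorem inner_mobius_neg_smul {p y : E} {t : ℝ} (hp : ‖p‖ = 1) (hy : ‖y‖ = 1) :
    inner ℝ (mobius (-(t • p)) y) p =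
      ((1 + t ^ 2) * inner ℝ y p - 2 * t) / (1 - 2 * t * inner ℝ y p + t ^ 2) := by
  simp only [mobius, hy, inner_smul_left, inner_add_left, inner_neg_left, norm_neg, norm_smul, hp,
    real_inner_self_eq_norm_sq, real_inner_comm y p, RCLike.conj_to_real, Real.norm_eq_abs, sq_abs,
    one_pow, mul_one]
  rw [inv_mul_eq_div]
  congr 1 <;> ring

theorem norm_hyperplaneReflection {p : E} (hp : ‖p‖ = 1) (y : E) :
    ‖hyperplaneReflection p y‖ = ‖y‖ := by
  have h : ‖hyperplaneReflection p y‖ ^ 2 = ‖y‖ ^ 2 := by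
    rw [hyperplaneReflection, norm_sub_sq_real, norm_smul, hp, inner_smul_right]
    simp only [Real.norm_eq_abs, mul_pow, sq_abs]
    ring
  exact (sq_eq_sq₀ (norm_nonneg _) (norm_nonneg _)).1 h

theorem hyperplaneReflection_sub (p y z : E) :
    hyperplaneReflection p y - hyperplaneReflection p z = hyperplaneReflection p (y - z) := by
  simp only [hyperplaneReflection, inner_sub_left]
  match_scalars <;> ring

theorem inner_hyperplaneReflection {p : E} (hp : ‖p‖ = 1) (y : E) :
    inner ℝ p (hyperplaneReflection p y) = -inner ℝ y p := by
  rw [hyperplaneReflection, inner_sub_right, inner_smul_right, real_inner_self_eq_norm_sq, hp,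
    real_inner_comm y p]
  ring

theorem norm_smul_lt_one {p : E} {t : ℝ} (hp : ‖p‖ = 1) (ht0 : 0 ≤ t) (ht1 : t < 1) :
    ‖t • p‖ < 1 := by
  rwa [norm_smul, hp, mul_one, Real.norm_eq_abs, abs_of_nonneg ht0]

theorem norm_sub_sq_of_norm_eq_one {p y : E} (hp : ‖p‖ = 1) (hy : ‖y‖ = 1) :
    ‖y - p‖ ^ 2 = 2 - 2 * inner ℝ y p := by
  rw [norm_sub_sq_real, hp, hy]; ring

/-- The chordal distance of two reflected points. -/
theorem norm_capReflection_sub_sq {p y z : E} {t : ℝ} (hp : ‖p‖ = 1) (hy : ‖y‖ = 1)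
    (hz : ‖z‖ = 1) (ht0 : 0 ≤ t) (ht1 : t < 1) :
    ‖capReflection p t y - capReflection p t z‖ ^ 2 = (1 - t ^ 2) ^ 4 * ‖y - z‖ ^ 2 /
      (((1 - t) ^ 4 + 2 * t * (1 + t ^ 2) * ‖y - p‖ ^ 2) *
        ((1 - t) ^ 4 + 2 * t * (1 + t ^ 2) * ‖z - p‖ ^ 2)) := by
  have hx : ‖t • p‖ < 1 := norm_smul_lt_one hp ht0 ht1
  have hx' : ‖-(t • p)‖ < 1 := by rwa [norm_neg]
  have hnx : ‖t • p‖ ^ 2 = t ^ 2 := by rw [norm_smul, hp, mul_one, Real.norm_eq_abs, sq_abs]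
  have hD : ∀ w : E, ‖w‖ = 1 → 0 < 1 - 2 * t * inner ℝ w p + t ^ 2 := fun w hw => by
    have := one_add_two_inner_add_norm_sq_pos hx' hw
    rw [norm_neg, hnx, inner_neg_left, inner_smul_left, real_inner_comm w p] at this
    simp only [RCLike.conj_to_real] at this
    linarith
  -- The denominator here is the one of `T_{-tp}` at `w`, so it cancels when the two distortion
  -- formulas are composed.
  have hQ : ∀ w : E, ‖w‖ = 1 → 1 + 2 * inner ℝ (t • p)
      (hyperplaneReflection p (mobius (-(t • p)) w)) + ‖t • p‖ ^ 2 =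
      ((1 - t) ^ 4 + 2 * t * (1 + t ^ 2) * ‖w - p‖ ^ 2) / (1 - 2 * t * inner ℝ w p + t ^ 2) := by
    intro w hw
    have := hD w hw
    rw [hnx, inner_smul_left, inner_hyperplaneReflection hp, inner_mobius_neg_smul hp hw,
      norm_sub_sq_of_norm_eq_one hp hw]
    simp only [RCLike.conj_to_real]
    field_simp
    ring
  have hD' : ∀ w : E, 1 + 2 * inner ℝ (-(t • p)) w + ‖-(t • p)‖ ^ 2 =
      1 - 2 * t * inner ℝ w p + t ^ 2 := fun w => by
    rw [norm_neg, hnx, inner_neg_left, inner_smul_left, real_inner_comm w p]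
    simp only [RCLike.conj_to_real]
    ring
  have hpos : ∀ w : E, 0 < (1 - t) ^ 4 + 2 * t * (1 + t ^ 2) * ‖w - p‖ ^ 2 := fun w => by
    have : 0 < 1 - t := by linarith
    positivity
  rw [capReflection, capReflection, norm_mobius_sub_mobius_sq hx
      ((norm_hyperplaneReflection hp _).trans (norm_mobius hx' hy))
      ((norm_hyperplaneReflection hp _).trans (norm_mobius hx' hz)),
    hyperplaneReflection_sub, norm_hyperplaneReflection hp, norm_mobius_sub_mobius_sq hx' hy hz,
    hQ y hy, hQ z hz, hD', hD', norm_neg, hnx]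
  have h1 := hD y hy
  have h2 := hD z hz
  have h3 := hpos y
  have h4 := hpos z
  generalize 1 - 2 * t * inner ℝ y p + t ^ 2 = a at h1 ⊢
  generalize 1 - 2 * t * inner ℝ z p + t ^ 2 = b at h2 ⊢
  generalize (1 - t) ^ 4 + 2 * t * (1 + t ^ 2) * ‖y - p‖ ^ 2 = c at h3 ⊢
  generalize (1 - t) ^ 4 + 2 * t * (1 + t ^ 2) * ‖z - p‖ ^ 2 = d at h4 ⊢
  field_simp

/-- Off the cap `H_{p,t}` all points of the sphere are close to `p`. -/
theorem norm_sub_sq_lt_of_notMem_sphericalCap {p y : E} {t : ℝ} (hp : ‖p‖ = 1) (hy : ‖y‖ = 1)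
    (ht0 : 0 ≤ t) (ht1 : t < 1) (h : y ∉ sphericalCap p t) : ‖y - p‖ ^ 2 < 2 * (1 - t) ^ 2 := by
  have hx : ‖-(t • p)‖ < 1 := by rw [norm_neg]; exact norm_smul_lt_one hp ht0 ht1
  have hpos : 0 < inner ℝ (mobius (-(t • p)) y) p := by
    by_contra! hle
    refine h ⟨mobius (-(t • p)) y, ⟨?_, hle⟩, ?_⟩
    · simpa using norm_mobius hx hy
    · simpa using mobius_neg_mobius hx hy
  rw [inner_mobius_neg_smul hp hy] at hpos
  have hD : 0 < 1 - 2 * t * inner ℝ y p + t ^ 2 := by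
    have : |inner ℝ y p| ≤ 1 := by simpa [hy, hp] using abs_real_inner_le_norm y p
    nlinarith [le_abs_self (inner ℝ y p)]
  have hnum := (div_pos_iff_of_pos_right hD).1 hpos
  have hle : inner ℝ y p ≤ 1 := by simpa [hy, hp] using real_inner_le_norm y p
  rw [norm_sub_sq_of_norm_eq_one hp hy]
  -- `hnum` says `y · p > 2t / (1 + t²)`, hence `2 - 2 y · p < 2 (1 - t)² / (1 + t²)`.
  nlinarith [sq_nonneg t]

/-! ### The stereographic model. -/

/-- Inverse stereographic projection from the unit vector `e`, on vectors orthogonal to `e`. -/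
noncomputable def inverseStereographic (e x : E) : E :=
  (1 + ‖x‖ ^ 2)⁻¹ • ((2 : ℝ) • x + (‖x‖ ^ 2 - 1) • e)

theorem norm_inverseStereographic {e x : E} (he : ‖e‖ = 1) (hx : inner ℝ x e = 0) :
    ‖inverseStereographic e x‖ = 1 := by
  have h : ‖inverseStereographic e x‖ ^ 2 = 1 := by
    rw [← real_inner_self_eq_norm_sq]
    simp only [inverseStereographic, he, inner_smul_left, inner_smul_right, inner_add_left,
      inner_add_right, real_inner_self_eq_norm_sq, real_inner_comm x e, hx, RCLike.conj_to_real]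
    field_simp
    ring
  nlinarith [norm_nonneg (inverseStereographic e x)]

theorem norm_inverseStereographic_sub_sq {e x y : E} (he : ‖e‖ = 1) (hx : inner ℝ x e = 0)
    (hy : inner ℝ y e = 0) :
    ‖inverseStereographic e x - inverseStereographic e y‖ ^ 2 =
      4 * ‖x - y‖ ^ 2 / ((1 + ‖x‖ ^ 2) * (1 + ‖y‖ ^ 2)) := by
  rw [norm_sub_sq_real, norm_inverseStereographic he hx, norm_inverseStereographic he hy,
    norm_sub_sq_real]
  simp only [inverseStereographic, he, inner_smul_left, inner_smul_right, inner_add_left,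
    inner_add_right, real_inner_self_eq_norm_sq, real_inner_comm y e, hx, hy,
    RCLike.conj_to_real]
  field_simp
  ring

end FoldMapGeometry

/-! ### Comparison of measures, linearization of `γ`, comparison with the model. -/

/-- A map whose distances are dominated by those of another map has an image of dominated
Hausdorff measure. -/
theorem hausdorffMeasure_image_le_of_dist_le {α X Y : Type*}
    [MetricSpace X] [MeasurableSpace X] [BorelSpace X] [MetricSpace Y] [MeasurableSpace Y]
    [BorelSpace Y] {f : α → X} {g : α → Y} {s : Set α} {K : NNReal} {d : ℝ} (hd : 0 ≤ d)
    (h : ∀ x ∈ s, ∀ y ∈ s, dist (f x) (f y) ≤ K * dist (g x) (g y)) :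
    μH[d] (f '' s) ≤ (K : ENNReal) ^ d * μH[d] (g '' s) := by
  rcases s.eq_empty_or_nonempty with rfl | ⟨a, _⟩
  · simp
  have : Nonempty α := ⟨a⟩
  have hm : ∀ y ∈ g '' s, Function.invFunOn g s y ∈ s := fun y hy => Function.invFunOn_mem hy
  have he : ∀ y ∈ g '' s, g (Function.invFunOn g s y) = y := fun y hy => Function.invFunOn_eq hy
  -- `g` need not be injective: the distance bound forces `f` to factor through `g` on `s`.
  have hL : LipschitzOnWith K (f ∘ Function.invFunOn g s) (g '' s) := by
    refine LipschitzOnWith.of_dist_le_mul fun y hy z hz => ?_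
    simpa only [Function.comp, he y hy, he z hz] using h _ (hm y hy) _ (hm z hz)
  refine le_trans (measure_mono ?_) (hL.hausdorffMeasure_image_le hd)
  rintro _ ⟨x, hx, rfl⟩
  refine ⟨g x, mem_image_of_mem g hx, ?_⟩
  have hgx := mem_image_of_mem g hx
  have := h _ (hm _ hgx) x hx
  rw [he _ hgx, dist_self, mul_zero] at this
  exact dist_le_zero.1 this

/-- A map that is `C¹` on a convex set of unique differentiability is strictly differentiable within
the set. -/
theorem ContDiffOn.exists_norm_image_sub_sub_le {E F : Type*} [NormedAddCommGroup E]
    [NormedSpace ℝ E] [NormedAddCommGroup F] [NormedSpace ℝ F] {f : E → F} {s : Set E} {a : E}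
    (hf : ContDiffOn ℝ 1 f s) (hs : UniqueDiffOn ℝ s) (hc : Convex ℝ s) (ha : a ∈ s) {ε : ℝ}
    (hε : 0 < ε) :
    ∃ δ > 0, ∀ x ∈ s ∩ ball a δ, ∀ y ∈ s ∩ ball a δ,
      ‖f x - f y - fderivWithin ℝ f s a (x - y)‖ ≤ ε * ‖x - y‖ := by
  obtain ⟨δ, hδ, h⟩ := Metric.continuousWithinAt_iff.1
    (hf.continuousOn_fderivWithin hs le_rfl a ha) ε hε
  refine ⟨δ, hδ, fun x hx y hy => ?_⟩
  -- Mean value inequality for `f` minus its differential at `a`.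
  refine (hc.inter (convex_ball a δ)).norm_image_sub_le_of_norm_hasFDerivWithin_le'
    (f' := fderivWithin ℝ f s) (fun z hz => ?_) (fun z hz => ?_) hy hx
  · exact ((hf.differentiableOn one_ne_zero z hz.1).hasFDerivWithinAt).mono inter_subset_left
  · rw [← dist_eq_norm]
    exact (h hz.1 hz.2).le

/-- Here `v`, `w` are the linearized positions of `y`, `z` relative to `p`. Each denominator factor
loses `(1 - η) ^ 3`: two powers from the bound on `‖v‖` or `‖w‖`, one from `htη`. Their product `(1
- η) ^ 6` becomes `(1 - η) ^ 3` after the square root. -/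
theorem norm_capReflection_sub_le {E V : Type*} [NormedAddCommGroup E] [InnerProductSpace ℝ E]
    [NormedAddCommGroup V] [InnerProductSpace ℝ V] {p y z : E} {e v w : V} {t η : ℝ}
    (hp : ‖p‖ = 1) (hy : ‖y‖ = 1) (hz : ‖z‖ = 1) (ht0 : 0 ≤ t) (ht1 : t < 1) (he : ‖e‖ = 1)
    (hv : inner ℝ v e = 0) (hw : inner ℝ w e = 0) (hη0 : 0 < η) (hη1 : η < 1)
    (htη : 1 - η ≤ t * (1 + t ^ 2) / 2) (hyz : ‖y - z‖ ≤ (1 + η) * ‖v - w‖)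
    (hvy : (1 - η) * ‖v‖ ≤ ‖y - p‖) (hwz : (1 - η) * ‖w‖ ≤ ‖z - p‖) :
    ‖capReflection p t y - capReflection p t z‖ ≤ (1 + η) / (1 - η) ^ 3 *
      ‖inverseStereographic e ((2 / (1 - t) ^ 2) • v) -
        inverseStereographic e ((2 / (1 - t) ^ 2) • w)‖ := by
  have h1t : 0 < 1 - t := by linarith
  have h1η : 0 < 1 - η := by linarith
  have hcube : (1 - η) ^ 3 ≤ 1 := pow_le_one₀ h1η.le (by linarith)
  have hQ : ∀ {x : E} {u : V}, (1 - η) * ‖u‖ ≤ ‖x - p‖ →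
      (1 - η) ^ 3 * ((1 - t) ^ 4 + 4 * ‖u‖ ^ 2) ≤
        (1 - t) ^ 4 + 2 * t * (1 + t ^ 2) * ‖x - p‖ ^ 2 := by
    intro x u hu
    have h1 : ((1 - η) * ‖u‖) ^ 2 ≤ ‖x - p‖ ^ 2 := by gcongr
    calc (1 - η) ^ 3 * ((1 - t) ^ 4 + 4 * ‖u‖ ^ 2)
        = (1 - η) ^ 3 * (1 - t) ^ 4 + 4 * (1 - η) * ((1 - η) * ‖u‖) ^ 2 := by ring
      _ ≤ 1 * (1 - t) ^ 4 + 4 * (t * (1 + t ^ 2) / 2) * ‖x - p‖ ^ 2 := by gcongr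
      _ = _ := by ring
  refine le_of_sq_le_sq ?_ (by positivity)
  rw [norm_capReflection_sub_sq hp hy hz ht0 ht1, mul_pow, norm_inverseStereographic_sub_sq he
    (by rw [inner_smul_left, hv, mul_zero]) (by rw [inner_smul_left, hw, mul_zero]), ← smul_sub]
  have hs : ∀ u : V, ‖(2 / (1 - t) ^ 2) • u‖ ^ 2 = 4 * ‖u‖ ^ 2 / (1 - t) ^ 4 := fun u => by
    rw [norm_smul, mul_pow, Real.norm_eq_abs, sq_abs]
    field_simp
    ring
  rw [hs, hs, hs]
  have h4 : (1 - t ^ 2) ^ 4 ≤ 16 * (1 - t) ^ 4 := by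
    have : (1 + t) ^ 4 ≤ 2 ^ 4 := by gcongr; linarith
    calc (1 - t ^ 2) ^ 4 = (1 - t) ^ 4 * (1 + t) ^ 4 := by ring
      _ ≤ (1 - t) ^ 4 * 2 ^ 4 := by gcongr
      _ = _ := by ring
  calc (1 - t ^ 2) ^ 4 * ‖y - z‖ ^ 2 /
        (((1 - t) ^ 4 + 2 * t * (1 + t ^ 2) * ‖y - p‖ ^ 2) *
          ((1 - t) ^ 4 + 2 * t * (1 + t ^ 2) * ‖z - p‖ ^ 2))
      ≤ 16 * (1 - t) ^ 4 * ((1 + η) * ‖v - w‖) ^ 2 /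
        (((1 - η) ^ 3 * ((1 - t) ^ 4 + 4 * ‖v‖ ^ 2)) *
          ((1 - η) ^ 3 * ((1 - t) ^ 4 + 4 * ‖w‖ ^ 2))) := by
        gcongr
        · exact hQ hvy
        · exact hQ hwz
    _ = _ := by
        have : 0 < (1 - t) ^ 4 + 4 * ‖v‖ ^ 2 := by positivity
        have : 0 < (1 - t) ^ 4 + 4 * ‖w‖ ^ 2 := by positivity
        have hr : ∀ a : ℝ, 1 + 4 * a / (1 - t) ^ 4 = ((1 - t) ^ 4 + 4 * a) / (1 - t) ^ 4 :=
          fun a => by field_simp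
        rw [hr, hr]
        generalize (1 - t) ^ 4 + 4 * ‖v‖ ^ 2 = a at *
        generalize (1 - t) ^ 4 + 4 * ‖w‖ ^ 2 = b at *
        generalize (1 - t) ^ 4 = c at *
        field_simp
        ring

/-- The range of an injective linear map on `ℝ^N` sits isometrically in the hyperplane orthogonal to
any unit vector of `ℝ^{N+1}`. -/
theorem exists_norm_preserving_orthogonal {N : ℕ} {E : Type*} [NormedAddCommGroup E]
    [InnerProductSpace ℝ E] {A : EuclideanSpace ℝ (Fin N) →ₗ[ℝ] E} (hA : Function.Injective A)
    {e : EuclideanSpace ℝ (Fin (N + 1))} (he : ‖e‖ = 1) :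
    ∃ B : EuclideanSpace ℝ (Fin N) →ₗ[ℝ] EuclideanSpace ℝ (Fin (N + 1)),
      ∀ u, ‖B u‖ = ‖A u‖ ∧ inner ℝ (B u) e = 0 := by
  have hfin : Module.finrank ℝ (LinearMap.range A) = N := by
    rw [LinearMap.finrank_range_of_inj hA, finrank_euclideanSpace_fin]
  have : Fact (Module.finrank ℝ (EuclideanSpace ℝ (Fin (N + 1))) = N + 1) :=
    ⟨finrank_euclideanSpace_fin⟩
  have he0 : e ≠ 0 := fun h => by simp [h] at he
  let φ : LinearMap.range A ≃ₗᵢ[ℝ] EuclideanSpace ℝ (Fin N) :=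
    ((stdOrthonormalBasis ℝ (LinearMap.range A)).reindex (finCongr hfin)).repr
  let ψ := (OrthonormalBasis.fromOrthogonalSpanSingleton (𝕜 := ℝ) N he0).repr
  refine ⟨(Submodule.subtype _) ∘ₗ (ψ.symm.toLinearEquiv.toLinearMap) ∘ₗ
    (φ.toLinearEquiv.toLinearMap) ∘ₗ A.rangeRestrict, fun u => ⟨?_, ?_⟩⟩
  · have h1 : ‖ψ.symm (φ (A.rangeRestrict u))‖ = ‖A u‖ := by
      rw [LinearIsometryEquiv.norm_map, LinearIsometryEquiv.norm_map]; rfl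
    exact h1
  · have := (ψ.symm (φ (A.rangeRestrict u))).2
    rw [Submodule.mem_orthogonal_singleton_iff_inner_left] at this
    exact this

/-! ### The limit `t → 1`. -/

/-- If `γ` passes through `p`, then every small enough part of `γ` around that point is reflected to
a set of measure at most slightly more than that of the unit sphere. -/
theorem eventually_hausdorffMeasure_capReflection_le {N M : ℕ}
    {γ : EuclideanSpace ℝ (Fin N) → EuclideanSpace ℝ (Fin (M + 1))}
    (hγ : IsSmoothEmbeddedBall γ) {a : EuclideanSpace ℝ (Fin N)} (ha : a ∈ closedBall 0 1)
    {η : ℝ} (hη0 : 0 < η) (hη1 : η < 1) :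
    ∃ δ > 0, ∀ᶠ t in 𝓝[<] (1 : ℝ),
      μH[N] ((capReflection (γ a) t ∘ γ) '' (closedBall 0 1 ∩ ball a δ)) ≤
        ENNReal.ofReal ((1 + η) / (1 - η) ^ 3) ^ (N : ℝ) *
          μH[N] (sphere (0 : EuclideanSpace ℝ (Fin (N + 1))) 1) := by
  have huniq : UniqueDiffOn ℝ (closedBall (0 : EuclideanSpace ℝ (Fin N)) 1) :=
    uniqueDiffOn_convex (convex_closedBall 0 1)
      ⟨0, ball_subset_interior_closedBall (mem_ball_self one_pos)⟩
  set A := fderivWithin ℝ γ (closedBall 0 1) a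
  have hA : Function.Injective A := hγ.injective_fderivWithin a ha
  obtain ⟨K, hK, hanti⟩ := A.toLinearMap.exists_antilipschitzWith (LinearMap.ker_eq_bot.2 hA)
  have hlow : ∀ u, ‖u‖ ≤ K * ‖A u‖ := fun u => by
    simpa using hanti.le_mul_norm (map_zero _) u
  -- Dividing by the antilipschitz constant `K` of `A` turns the error into one relative to `‖A (x -
  -- y)‖`.
  obtain ⟨δ, hδ, h⟩ := (hγ.contDiffOn.of_le (by simp)).exists_norm_image_sub_sub_le huniq
    (convex_closedBall 0 1) ha (ε := η / K) (by positivity)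
  have h' : ∀ x ∈ closedBall 0 1 ∩ ball a δ, ∀ y ∈ closedBall 0 1 ∩ ball a δ,
      ‖γ x - γ y - A (x - y)‖ ≤ η * ‖A (x - y)‖ := fun x hx y hy => by
    refine (h x hx y hy).trans ?_
    calc η / K * ‖x - y‖ ≤ η / K * (K * ‖A (x - y)‖) := by gcongr; exact hlow _
      _ = η * ‖A (x - y)‖ := by field_simp
  have hnorm : ∀ x ∈ closedBall (0 : EuclideanSpace ℝ (Fin N)) 1, ‖γ x‖ = 1 := fun x hx => by
    simpa using hγ.mapsTo hx
  obtain ⟨e, he⟩ : ∃ e : EuclideanSpace ℝ (Fin (N + 1)), ‖e‖ = 1 := exists_norm_eq _ zero_le_one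
  obtain ⟨B, hB⟩ := exists_norm_preserving_orthogonal (A := A.toLinearMap) hA he
  have hBn : ∀ u, ‖B u‖ = ‖A u‖ := fun u => (hB u).1
  have ha' : a ∈ closedBall (0 : EuclideanSpace ℝ (Fin N)) 1 ∩ ball a δ := ⟨ha, mem_ball_self hδ⟩
  have hlower : ∀ x ∈ closedBall 0 1 ∩ ball a δ, (1 - η) * ‖B (x - a)‖ ≤ ‖γ x - γ a‖ :=
    fun x hx => by
      have h1 := h' x hx a ha'
      have h2 := norm_sub_norm_le (A (x - a)) (γ x - γ a)
      rw [norm_sub_rev (A (x - a))] at h2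
      rw [hBn]
      linarith
  have hevent : ∀ᶠ t in 𝓝[<] (1 : ℝ), 1 - η ≤ t * (1 + t ^ 2) / 2 := by
    have : Tendsto (fun t : ℝ => t * (1 + t ^ 2) / 2) (𝓝[<] 1) (𝓝 (1 * (1 + 1 ^ 2) / 2)) :=
      ((by fun_prop : Continuous fun t : ℝ => t * (1 + t ^ 2) / 2).tendsto 1).mono_left
        nhdsWithin_le_nhds
    exact this.eventually (Ici_mem_nhds (by norm_num; linarith))
  refine ⟨δ, hδ, ?_⟩
  filter_upwards [hevent, Ico_mem_nhdsLT (zero_lt_one' ℝ)] with t ht ht01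
  refine (hausdorffMeasure_image_le_of_dist_le
    (K := Real.toNNReal ((1 + η) / (1 - η) ^ 3))
    (g := fun x => inverseStereographic e ((2 / (1 - t) ^ 2) • B (x - a)))
    (Nat.cast_nonneg N) fun x hx y hy => ?_).trans ?_
  · have h1η : 0 < 1 - η := by linarith
    rw [Real.coe_toNNReal _ (by positivity), dist_eq_norm, dist_eq_norm]
    refine norm_capReflection_sub_le (hnorm a ha) (hnorm x hx.1) (hnorm y hy.1) ht01.1 ht01.2 he
      (hB _).2 (hB _).2 hη0 hη1 ht ?_ (hlower x hx) (hlower y hy)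
    rw [← map_sub, sub_sub_sub_cancel_right, hBn]
    have h1 := h' x hx y hy
    have h2 := norm_sub_norm_le (γ x - γ y) (A (x - y))
    linarith
  · refine mul_le_mul_right (measure_mono ?_) _
    rintro _ ⟨x, -, rfl⟩
    rw [mem_sphere_zero_iff_norm]
    exact norm_inverseStereographic he (by rw [inner_smul_left, (hB _).2, mul_zero])

/-- The folded part of the ball shrinks to the preimage of `p`. -/
theorem eventually_dist_lt_of_notMem_sphericalCap {N M : ℕ}
    {γ : EuclideanSpace ℝ (Fin N) → EuclideanSpace ℝ (Fin (M + 1))}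
    (hγ : IsSmoothEmbeddedBall γ) {p : EuclideanSpace ℝ (Fin (M + 1))} (hp : ‖p‖ = 1)
    {U : Set (EuclideanSpace ℝ (Fin N))} (hU : IsOpen U)
    (hpU : ∀ z ∈ closedBall 0 1, γ z = p → z ∈ U) :
    ∀ᶠ t in 𝓝[<] (1 : ℝ), ∀ z ∈ closedBall 0 1, γ z ∉ sphericalCap p t → z ∈ U := by
  have hcomp : IsCompact (γ '' (closedBall 0 1 \ U)) :=
    ((isCompact_closedBall 0 1).diff hU).image_of_continuousOn
      (hγ.contDiffOn.continuousOn.mono sdiff_subset)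
  -- The compact image of the complement of `U` misses `p`, hence stays at a positive distance `r`
  -- from it.
  have hpn : p ∈ (γ '' (closedBall 0 1 \ U))ᶜ := by
    rintro ⟨z, hz, hzp⟩
    exact hz.2 (hpU z hz.1 hzp)
  obtain ⟨r, hr, hball⟩ := Metric.isOpen_iff.1 hcomp.isClosed.isOpen_compl p hpn
  have hevent : ∀ᶠ t in 𝓝[<] (1 : ℝ), 2 * (1 - t) ^ 2 < r ^ 2 := by
    have : Tendsto (fun t : ℝ => 2 * (1 - t) ^ 2) (𝓝[<] 1) (𝓝 (2 * (1 - 1) ^ 2)) :=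
      ((by fun_prop : Continuous fun t : ℝ => 2 * (1 - t) ^ 2).tendsto 1).mono_left
        nhdsWithin_le_nhds
    exact this.eventually (Iio_mem_nhds (by norm_num; positivity))
  filter_upwards [hevent, Ico_mem_nhdsLT (zero_lt_one' ℝ)] with t ht ht01 z hz hcap
  by_contra hzU
  refine hball ?_ (mem_image_of_mem γ ⟨hz, hzU⟩)
  have hlt := (norm_sub_sq_lt_of_notMem_sphericalCap hp (by simpa using hγ.mapsTo hz)
    ht01.1 ht01.2 hcap).trans ht
  rw [mem_ball, dist_eq_norm]
  exact lt_of_pow_lt_pow_left₀ 2 hr.le hlt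

theorem image_foldMap_comp_subset {N M : ℕ}
    {γ : EuclideanSpace ℝ (Fin N) → EuclideanSpace ℝ (Fin (M + 1))}
    {p : EuclideanSpace ℝ (Fin (M + 1))} {t : ℝ} {s U : Set (EuclideanSpace ℝ (Fin N))}
    (h : ∀ z ∈ s, γ z ∉ sphericalCap p t → z ∈ U) :
    (foldMap p t ∘ γ) '' s ⊆ (capReflection p t ∘ γ) '' (s ∩ U) ∪ γ '' s := by
  rintro _ ⟨z, hz, rfl⟩
  by_cases hc : γ z ∈ sphericalCap p t
  · exact Or.inr ⟨z, hz, by simp [foldMap, hc]⟩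
  · exact Or.inl ⟨z, ⟨hz, h z hz hc⟩, by simp [foldMap, hc]⟩

theorem limsup_hausdorffMeasure_foldMap_le {N M : ℕ}
    {γ : EuclideanSpace ℝ (Fin N) → EuclideanSpace ℝ (Fin (M + 1))}
    (hγ : IsSmoothEmbeddedBall γ) {p : EuclideanSpace ℝ (Fin (M + 1))} (hp : ‖p‖ = 1)
    {η : ℝ} (hη0 : 0 < η) (hη1 : η < 1) :
    limsup (fun t : ℝ => μH[N] ((foldMap p t ∘ γ) '' closedBall 0 1)) (𝓝[<] 1) ≤
      ENNReal.ofReal ((1 + η) / (1 - η) ^ 3) ^ (N : ℝ) *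
        μH[N] (sphere (0 : EuclideanSpace ℝ (Fin (N + 1))) 1) + μH[N] (γ '' closedBall 0 1) := by
  obtain ⟨U, hU, hpU, hle⟩ : ∃ U : Set (EuclideanSpace ℝ (Fin N)), IsOpen U ∧
      (∀ z ∈ closedBall 0 1, γ z = p → z ∈ U) ∧ ∀ᶠ t in 𝓝[<] (1 : ℝ),
        μH[N] ((capReflection p t ∘ γ) '' (closedBall 0 1 ∩ U)) ≤
          ENNReal.ofReal ((1 + η) / (1 - η) ^ 3) ^ (N : ℝ) *
            μH[N] (sphere (0 : EuclideanSpace ℝ (Fin (N + 1))) 1) := by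
    by_cases hex : ∃ a ∈ closedBall 0 1, γ a = p
    · obtain ⟨a, ha, rfl⟩ := hex
      obtain ⟨δ, hδ, h⟩ := eventually_hausdorffMeasure_capReflection_le hγ ha hη0 hη1
      refine ⟨ball a δ, isOpen_ball, fun z hz hza => ?_, h⟩
      -- Injectivity makes `a` the only preimage, so a single sphere appears in the bound.
      rw [hγ.injOn hz ha hza]
      exact mem_ball_self hδ
    · push Not at hex
      exact ⟨∅, isOpen_empty, fun z hz hzp => absurd hzp (hex z hz), by simp⟩
  refine limsup_le_of_le (h := ?_)
  filter_upwards [hle, eventually_dist_lt_of_notMem_sphericalCap hγ hp hU hpU] with t ht hcap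
  exact (measure_mono (image_foldMap_comp_subset hcap)).trans
    ((measure_union_le _ _).trans (add_le_add_left ht _))

theorem mainTheorem6 (N M : ℕ) (hN : 1 ≤ N) (hNM : N < M)
    (γ : EuclideanSpace ℝ (Fin N) → EuclideanSpace ℝ (Fin (M + 1)))
    (hγ : IsSmoothEmbeddedBall γ)
    (p : EuclideanSpace ℝ (Fin (M + 1))) (hp : p ∈ sphere 0 1) :
    limsup (fun t : ℝ => μH[N] ((foldMap p t ∘ γ) '' closedBall 0 1)) (𝓝[<] 1) ≤
      μH[N] (sphere (0 : EuclideanSpace ℝ (Fin (N + 1))) 1) + μH[N] (γ '' closedBall 0 1) := by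
  rw [mem_sphere_zero_iff_norm] at hp
  have hK : Tendsto (fun η : ℝ => (1 + η) / (1 - η) ^ 3) (𝓝[>] 0) (𝓝 1) := by
    have : ContinuousAt (fun η : ℝ => (1 + η) / (1 - η) ^ 3) 0 :=
      ContinuousAt.div (by fun_prop) (by fun_prop) (by norm_num)
    simpa using this.tendsto.mono_left nhdsWithin_le_nhds
  have hlim : Tendsto (fun η : ℝ => ENNReal.ofReal ((1 + η) / (1 - η) ^ 3) ^ (N : ℝ) *
      μH[N] (sphere (0 : EuclideanSpace ℝ (Fin (N + 1))) 1) + μH[N] (γ '' closedBall 0 1))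
      (𝓝[>] 0) (𝓝 (μH[N] (sphere (0 : EuclideanSpace ℝ (Fin (N + 1))) 1) +
        μH[N] (γ '' closedBall 0 1))) := by
    have h1 : Tendsto (fun η : ℝ => ENNReal.ofReal ((1 + η) / (1 - η) ^ 3) ^ (N : ℝ))
        (𝓝[>] 0) (𝓝 1) := by
      simpa using (ENNReal.tendsto_ofReal hK).ennrpow_const (N : ℝ)
    -- The limit factor `1` is nonzero, so finiteness of the measure of the sphere is not needed.
    simpa using (ENNReal.Tendsto.mul_const h1 (Or.inl one_ne_zero)).add_const
      (μH[N] (γ '' closedBall 0 1))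
  refine ge_of_tendsto hlim ?_
  filter_upwards [Ioo_mem_nhdsGT (zero_lt_one' ℝ)] with η hη
  exact limsup_hausdorffMeasure_foldMap_le hγ hp hη.1 hη.2
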